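/- For each sample size $n$ let $p=p_n$ and $k=k_n$ be integers with $1\le k\le p$ and let $\sigma=\sigma_n>0$, $\tau=\tau_n>0$. Consider the linear model $y_i=x_i^T\beta+\sigma z_i$, $i=1,\dots,n$, with $\beta\in\mathbb{R}^p$, $x_i\overset{iid}{\sim}\mathcal N(0,\frac1n I_p)$ and $z_i\overset{iid}{\sim}\mathcal N(0,1)$ independent of the $x_i$; write $\mathbb{E}_\beta$ for the expectation under this model. Let $$\Theta(k,\tau)=\{\beta\in\mathbb{R}^p:\ \|\beta\|_0\le k,\ \|\beta\|_2^2\le k\tau^2\},\qquad R(\Theta(k,\tau),\sigma)=\inf_{\hat\beta}\ \sup_{\beta\in\Theta(k,\tau)}\mathbb{E}_\beta\|\hat\beta-\beta\|_2^2,$$ where $\|\beta\|_0$ is the number of non-zero components of $\beta$ and the infimum is over all estimators, i.e. measurable functions of $(x_i,y_i)_{i\le n}$. Let $\hat\beta^{BS}$ be the best subset selection estimator, i.e. any (measurable) choice $$\hat\beta^{BS}\in\operatorname*{arg\,min}_{b\in\mathbb{R}^p:\ \|b\|_0\le k}\ \sum_{i=1}^n (y_i-x_i^Tb)^2 .$$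 Suppose that, as $n\to\infty$, $k/p\to0$, $(k\log p)/n\to0$ and $\tau/\sigma=o\big(\sqrt{\log(p/k)}\big)$ (this covers both the low-SNR regime $\tau/\sigma\to0$ and the moderate-SNR regime $\tau/\sigma\to\infty$, $\tau/\sigma=o(\sqrt{\log(p/k)})$). Then, as $n\to\infty$, $$\frac{\sup_{\beta\in\Theta(k,\tau)}\mathbb{E}_\beta\|\hat\beta^{BS}-\beta\|_2^2}{R(\Theta(k,\tau),\sigma)}\ \longrightarrow\ \infty .$$ -/

import Mathlib

open scoped ENNReal NNReal Topology
open MeasureTheory ProbabilityTheory Filter Asymptotics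

namespace SparseRegression

/-- Covariates of the `n` samples: `x i` is the covariate vector `x_i ∈ ℝ^p`, i.e. the `i`-th row
of the design matrix. -/
abbrev Design (n p : ℕ) : Type := Fin n → Fin p → ℝ

/-- An (unrestricted) estimation rule: a map from the data `(X, y)` to `ℝ^p`, where `ℝ^p` carries
the Euclidean norm. -/
abbrev Estimator (n p : ℕ) : Type := Design n p × (Fin n → ℝ) → EuclideanSpace ℝ (Fin p)

/-- The linear predictor `(x_iᵀ b)_{i = 1, …, n}`. -/
def predict {n p : ℕ} (x : Design n p) (b : EuclideanSpace ℝ (Fin p)) : Fin n → ℝ :=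
  fun i => ∑ j, x i j * b j

/-- The number of non-zero components of a vector. -/
noncomputable def l0 {p : ℕ} (b : EuclideanSpace ℝ (Fin p)) : ℕ :=
  (Finset.univ.filter fun j => b j ≠ 0).card

/-- The parameter space `Θ(k, τ) = {β ∈ ℝ^p : ‖β‖₀ ≤ k, ‖β‖₂² ≤ k τ²}`. -/
def Theta (p k : ℕ) (τ : ℝ) : Set (EuclideanSpace ℝ (Fin p)) :=
  {β | l0 β ≤ k ∧ ‖β‖ ^ 2 ≤ k * τ ^ 2}

/-- Law of the covariates: `x_1, …, x_n` i.i.d. `N(0, (1/n) I_p)`. -/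
noncomputable def designLaw (n p : ℕ) : Measure (Design n p) :=
  Measure.pi fun _ => Measure.pi fun _ => gaussianReal 0 (1 / (n : ℝ≥0))

/-- Law of the errors: `z_1, …, z_n` i.i.d. `N(0, 1)`. -/
noncomputable def noiseLaw (n : ℕ) : Measure (Fin n → ℝ) :=
  Measure.pi fun _ => gaussianReal 0 1

/-- Law of the data `(X, y)` under `y_i = x_iᵀ β + σ z_i`, with `z` independent of `X`. -/
noncomputable def dataLaw (n p : ℕ) (σ : ℝ) (β : EuclideanSpace ℝ (Fin p)) :
    Measure (Design n p × (Fin n → ℝ)) :=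
  ((designLaw n p).prod (noiseLaw n)).map fun w => (w.1, predict w.1 β + σ • w.2)

/-- The risk `E_β ‖δ(X, y) - β‖₂²`, as an extended nonnegative number. -/
noncomputable def risk {n p : ℕ} (σ : ℝ) (δ : Estimator n p)
    (β : EuclideanSpace ℝ (Fin p)) : ℝ≥0∞ :=
  ∫⁻ d, ENNReal.ofReal (‖δ d - β‖ ^ 2) ∂(dataLaw n p σ β)

/-- The worst-case risk over `Θ(k, τ)`. -/
noncomputable def worstRisk {n p : ℕ} (k : ℕ) (τ σ : ℝ) (δ : Estimator n p) : ℝ≥0∞ :=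
  ⨆ β ∈ Theta p k τ, risk σ δ β

/-- The minimax risk `R(Θ(k, τ), σ)`: the infimum of the worst-case risk over all estimators,
i.e. all measurable functions of the data. -/
noncomputable def minimaxRisk (n p k : ℕ) (τ σ : ℝ) : ℝ≥0∞ :=
  ⨅ (δ : Estimator n p) (_ : Measurable δ), worstRisk k τ σ δ

/-- The residual sum of squares `∑ i, (y_i - x_iᵀ b)²`. -/
def rss {n p : ℕ} (d : Design n p × (Fin n → ℝ)) (b : EuclideanSpace ℝ (Fin p)) : ℝ :=
  ∑ i, (d.2 i - predict d.1 b i) ^ 2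

/-- `δ` is a best subset selection estimator with sparsity `k`: on every data set, it is a
minimizer (ties being broken arbitrarily) of the residual sum of squares over all `b` with
`‖b‖₀ ≤ k`. -/
def IsBestSubsetSelection {n p : ℕ} (k : ℕ) (δ : Estimator n p) : Prop :=
  ∀ d, l0 (δ d) ≤ k ∧ ∀ b, l0 b ≤ k → rss d (δ d) ≤ rss d b

end SparseRegression

namespace SparseRegression

/-! Write `L = log (p / k)`. The zero estimator bounds the minimax risk by `k τ²`
(`minimaxRisk_le`). Best subset selection overfits: already at `β = 0` its risk is at least `c σ² k
L` (`worstRisk_bestSubset_ge`). The ratio is thus at least `c L σ² / τ²`, which diverges by the SNR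
assumption.

For the lower bound, fix the noise and let `u` be its direction. By rotation invariance the
component of the design along `u` may be replaced by an independent vector `g / √n`
(`map_resample`), so that `Xᵀy` is a multiple of the standard Gaussian `g`. A competitor equal to a
multiple of `√L` on at most `k` coordinates where `g` exceeds `√(L / 2)` lowers the residual sum of
squares by order `k L` in expectation (`exists_selection_of_log`). The minimizer `v` does at least
as well, and its gain is at most `2⟨v, Xᵀy⟩`. Since the `k` largest squares of `g` sum to `O(k L)`
in expectation (`integral_topBound`), such a gain forces `‖v‖²` to be of order `k L`
(`norm_sq_bestSubset_ge`, `lintegral_bestSubset_ge`). -/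

instance (n p : ℕ) : IsProbabilityMeasure (designLaw n p) := by
  unfold designLaw; infer_instance

instance (n : ℕ) : IsProbabilityMeasure (noiseLaw n) := by
  unfold noiseLaw; infer_instance

/-! ### Gaussian design: resampling one direction, second moments -/

theorem charFunDual_pi_gaussianReal {ι : Type*} [Fintype ι] [DecidableEq ι] (v : ℝ≥0)
    (L : StrongDual ℝ (ι → ℝ)) :
    charFunDual (Measure.pi fun _ : ι => gaussianReal 0 v) L =
      Complex.exp (-((v * ∑ i, L (Pi.single i 1) ^ 2 / 2 : ℝ) : ℂ)) := by
  rw [charFunDual_pi]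
  have h (i : ι) : charFunDual (gaussianReal 0 v) (L.comp (.single ℝ (fun _ => ℝ) i)) =
      Complex.exp (-((v * (L (Pi.single i 1) ^ 2 / 2) : ℝ) : ℂ)) := by
    have h1 : charFunDual (gaussianReal 0 v) (L.comp (.single ℝ (fun _ => ℝ) i)) =
        charFun (gaussianReal 0 v) (L (Pi.single i 1)) := by
      rw [charFunDual_apply, charFun_apply_real]
      congr 1
      ext x
      have : Pi.single i x = x • (Pi.single i 1 : ι → ℝ) := by
        rw [← Pi.single_smul]; simp
      simp only [ContinuousLinearMap.comp_apply, ContinuousLinearMap.single_apply, this, map_smul]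
      push_cast [smul_eq_mul]
      ring_nf
    rw [h1, charFun_gaussianReal]
    congr 1
    push_cast
    ring
  simp_rw [h]
  rw [← Complex.exp_sum, Finset.mul_sum]
  push_cast
  simp

theorem charFunDual_designLaw {n p : ℕ} (L : StrongDual ℝ (Design n p)) :
    charFunDual (designLaw n p) L =
      Complex.exp (-(((n : ℝ)⁻¹ * ∑ i, ∑ j, L (Pi.single i (Pi.single j 1)) ^ 2 / 2 : ℝ) : ℂ)) := by
  rw [designLaw, charFunDual_pi]
  simp_rw [charFunDual_pi_gaussianReal]
  rw [← Complex.exp_sum, Finset.mul_sum]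
  push_cast
  simp

theorem dual_design_apply {n p : ℕ} (L : StrongDual ℝ (Design n p)) (x : Design n p) :
    L x = ∑ i, ∑ j, x i j * L (Pi.single i (Pi.single j 1)) := by
  have hx : x = ∑ i, ∑ j, x i j • (Pi.single i (Pi.single j (1 : ℝ)) : Design n p) := by
    ext i j
    simp [Finset.sum_apply, Pi.single_apply, apply_ite, ite_apply]
  conv_lhs => rw [hx]
  simp [map_sum]

/-- Replace the component along `u` of the columns of a design matrix by fresh coordinates. -/
noncomputable def resample {n p : ℕ} (u : Fin n → ℝ) :
    Design n p × (Fin p → ℝ) →L[ℝ] Design n p :=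
  LinearMap.toContinuousLinearMap
    { toFun := fun w i j => w.1 i j - u i * ∑ l, u l * w.1 l j + u i * (w.2 j / √n)
      map_add' := fun v w => by
        ext i j
        simp only [Prod.fst_add, Prod.snd_add, Pi.add_apply, mul_add, Finset.sum_add_distrib]
        ring
      map_smul' := fun c w => by
        ext i j
        simp only [Prod.smul_fst, Prod.smul_snd, Pi.smul_apply, smul_eq_mul, RingHom.id_apply]
        have : ∑ l, u l * (c * w.1 l j) = c * ∑ l, u l * w.1 l j := by
          rw [Finset.mul_sum]; exact Finset.sum_congr rfl fun _ _ => by ring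
        rw [this]; ring }

theorem resample_apply {n p : ℕ} (u : Fin n → ℝ) (w : Design n p × (Fin p → ℝ)) (i : Fin n)
    (j : Fin p) :
    resample u w i j = w.1 i j - u i * ∑ l, u l * w.1 l j + u i * (w.2 j / √n) := rfl

/-- The characteristic function depends on a functional only through the sum of squares of its
coefficients. Each column of coefficients splits orthogonally into its part along `u` and the rest,
so Pythagoras gives equality. The factor `1 / √n` gives the fresh coordinates the variance of the
design entries. -/
theorem map_resample {n p : ℕ} (u : Fin n → ℝ) (hu : ∑ i, u i ^ 2 = 1) :
    ((designLaw n p).prod (noiseLaw p)).map (resample u) = designLaw n p := by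
  have hn : (n : ℝ) ≠ 0 := by
    rintro h
    have : n = 0 := by exact_mod_cast h
    subst this
    simp at hu
  have : IsProbabilityMeasure (((designLaw n p).prod (noiseLaw p)).map (resample u)) :=
    Measure.isProbabilityMeasure_map (resample u).continuous.measurable.aemeasurable
  apply Measure.ext_of_charFunDual
  ext L
  rw [charFunDual_map, charFunDual_prod, charFunDual_designLaw, charFunDual_designLaw, noiseLaw,
    charFunDual_pi_gaussianReal, ← Complex.exp_add]
  congr 1
  rw [← neg_add, ← Complex.ofReal_add]
  congr 2
  set c : Fin n → Fin p → ℝ := fun i j => L (Pi.single i (Pi.single j 1)) with hc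
  -- The adjoint of `resample u` sends `c` to `(I - u uᵀ) c` on the design and to `uᵀ c / √n` on the
  -- fresh coordinates.
  have h1 (l : Fin n) (j : Fin p) :
      ((L.comp (resample u)).comp (.inl ℝ (Design n p) (Fin p → ℝ)))
        (Pi.single l (Pi.single j 1)) = c l j - u l * ∑ i, u i * c i j := by
    simp only [ContinuousLinearMap.comp_apply, ContinuousLinearMap.inl_apply]
    rw [dual_design_apply]
    simp only [resample_apply]
    have hs (i : Fin n) (j' : Fin p) : (Pi.single l (Pi.single j (1:ℝ)) : Design n p) i j' =
        if i = l then (if j' = j then 1 else 0) else 0 := by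
      simp only [Pi.single_apply]
      split_ifs <;> simp_all
    simp only [hs, Pi.zero_apply, zero_div, mul_zero, add_zero, sub_mul, Finset.sum_sub_distrib,
      mul_ite, ite_mul, zero_mul, one_mul, mul_one]
    simp only [Finset.sum_ite_eq', Finset.mem_univ, if_true]
    congr 1
    · rw [Finset.sum_comm]
      simp [hc]
    · simp [hc, Finset.mul_sum]
      exact Finset.sum_congr rfl fun _ _ => by ring
  have h2 (j : Fin p) :
      ((L.comp (resample u)).comp (.inr ℝ (Design n p) (Fin p → ℝ)))
        (Pi.single j 1) = (∑ i, u i * c i j) / √n := by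
    simp only [ContinuousLinearMap.comp_apply, ContinuousLinearMap.inr_apply]
    rw [dual_design_apply]
    simp only [resample_apply, Pi.zero_apply, mul_zero, Finset.sum_const_zero, sub_zero, zero_add,
      Pi.single_apply]
    simp [hc, ite_div, Finset.sum_div]
    exact Finset.sum_congr rfl fun _ _ => by ring
  simp only [h1, h2]
  have h3 (j : Fin p) : ∑ i, (c i j - u i * ∑ l, u l * c l j) ^ 2 =
      ∑ i, c i j ^ 2 - (∑ l, u l * c l j) ^ 2 := by
    set w := ∑ l, u l * c l j with hw
    have : ∀ i, (c i j - u i * w) ^ 2 = c i j ^ 2 - 2 * w * (u i * c i j) + w ^ 2 * u i ^ 2 :=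
      fun i => by ring
    simp only [this, Finset.sum_add_distrib, Finset.sum_sub_distrib, ← Finset.mul_sum, hu, ← hw]
    ring
  have h4 : ∑ i, ∑ j, (c i j - u i * ∑ l, u l * c l j) ^ 2 =
      ∑ i, ∑ j, c i j ^ 2 - ∑ j, (∑ l, u l * c l j) ^ 2 := by
    rw [Finset.sum_comm, Finset.sum_comm (f := fun i j => c i j ^ 2), ← Finset.sum_sub_distrib]
    exact Finset.sum_congr rfl fun j _ => h3 j
  simp only [← Finset.sum_div, h4, div_pow, Real.sq_sqrt (Nat.cast_nonneg n), NNReal.coe_one]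
  change _ = (n : ℝ)⁻¹ * ((∑ i, ∑ j, c i j ^ 2) / 2)
  ring

theorem integral_predict_sq {n p : ℕ} (b : EuclideanSpace ℝ (Fin p)) (i : Fin n) :
    Integrable (fun x : Design n p => predict x b i ^ 2) (designLaw n p) ∧
    ∫ x, predict x b i ^ 2 ∂(designLaw n p) = ‖b‖ ^ 2 / n := by
  set μ : Measure (Fin p → ℝ) := Measure.pi fun _ => gaussianReal 0 (1 / (n : ℝ≥0)) with hμ
  have hmem (j : Fin p) : MemLp (fun x : ℝ => x * b j) 2 (gaussianReal 0 (1 / (n : ℝ≥0))) :=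
    (memLp_id_gaussianReal' 2 (by simp)).mul_const _
  have hmem' (j : Fin p) : MemLp (fun x : Fin p → ℝ => x j * b j) 2 μ :=
    (hmem j).comp_measurePreserving (measurePreserving_eval _ j)
  have hS : MemLp (fun x : Fin p → ℝ => ∑ j, x j * b j) 2 μ := memLp_finsetSum _ fun j _ => hmem' j
  have hmean (j : Fin p) : ∫ x, x j * b j ∂μ = 0 := by
    rw [integral_comp_eval (μ := fun _ : Fin p => gaussianReal 0 (1 / (n : ℝ≥0))) (i := j)
      (f := fun x : ℝ => x * b j) (by fun_prop)]
    simp [integral_mul_const, integral_id_gaussianReal]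
  have hvar := variance_sum_pi (μ := fun _ : Fin p => gaussianReal 0 (1 / (n : ℝ≥0)))
    (X := fun j x => x * b j) hmem
  have hpres : MeasurePreserving (Function.eval i) (designLaw n p) μ :=
    measurePreserving_eval (fun _ : Fin n => μ) i
  constructor
  · exact hpres.integrable_comp_of_integrable hS.integrable_sq
  · have h1 : ∫ x, predict x b i ^ 2 ∂(designLaw n p) = ∫ x : Fin p → ℝ, (∑ j, x j * b j) ^ 2 ∂μ :=
      integral_comp_eval (μ := fun _ : Fin n => μ) (i := i)
        (f := fun x : Fin p → ℝ => (∑ j, x j * b j) ^ 2)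
        hS.integrable_sq.aestronglyMeasurable
    have h2 : ∫ x : Fin p → ℝ, ∑ j, x j * b j ∂μ = 0 := by
      rw [integral_finsetSum _ fun j _ => (hmem' j).integrable (by norm_num)]
      simp [hmean]
    have h3 : (∑ j, fun x : Fin p → ℝ => x j * b j) = fun x => ∑ j, x j * b j := by
      ext x; simp
    rw [h3, variance_of_integral_eq_zero hS.aestronglyMeasurable.aemeasurable h2] at hvar
    rw [h1, hvar, EuclideanSpace.norm_sq_eq, Finset.sum_div]
    refine Finset.sum_congr rfl fun j _ => ?_
    have := variance_mul_const (b j) (fun x : ℝ => x) (gaussianReal 0 (1 / (n : ℝ≥0)))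
    rw [this]
    rw [show (fun x : ℝ => x) = id from rfl, variance_id_gaussianReal]
    simp
    ring

/-! ### Gaussian tails, top-k sums and selection of large coordinates -/

theorem le_gaussianReal_Ioi (t : ℝ) (ht : 0 ≤ t) :
    Real.exp (-t ^ 2 - 1) / √(2 * Real.pi) ≤ (gaussianReal 0 1).real (Set.Ioi t) := by
  rw [measureReal_def, gaussianReal_apply_eq_integral 0 one_ne_zero, ENNReal.toReal_ofReal
    (setIntegral_nonneg measurableSet_Ioi fun x _ => gaussianPDFReal_nonneg _ _ _)]
  calc Real.exp (-t ^ 2 - 1) / √(2 * Real.pi)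
      = ∫ _ in Set.Ioc t (t + 1), Real.exp (-t ^ 2 - 1) / √(2 * Real.pi) := by simp
    _ ≤ ∫ x in Set.Ioc t (t + 1), gaussianPDFReal 0 1 x := by
        refine setIntegral_mono_on (by simp) (integrable_gaussianPDFReal 0 1).integrableOn
          measurableSet_Ioc fun x hx => ?_
        rw [gaussianPDFReal, div_eq_inv_mul]
        simp only [NNReal.coe_one, mul_one, sub_zero]
        gcongr
        -- On this interval `x² / 2 ≤ (t + 1)² / 2 ≤ t² + 1`.
        nlinarith [hx.1, hx.2, sq_nonneg (t - 1)]
    _ ≤ ∫ x in Set.Ioi t, gaussianPDFReal 0 1 x :=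
        setIntegral_mono_set (integrable_gaussianPDFReal 0 1).integrableOn
          (ae_of_all _ fun x => gaussianPDFReal_nonneg _ _ _)
          (Set.Ioc_subset_Ioi_self).eventuallyLE

theorem gaussianReal_Ioi_le_half (t : ℝ) (ht : 0 ≤ t) :
    (gaussianReal 0 1).real (Set.Ioi t) ≤ 1 / 2 := by
  have hmap : (gaussianReal 0 1).map (fun x => -x) = gaussianReal 0 1 := by
    rw [gaussianReal_map_neg]; simp
  have h1 : (gaussianReal 0 1).real (Set.Iio (-t)) = (gaussianReal 0 1).real (Set.Ioi t) := by
    conv_rhs => rw [← hmap]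
    rw [map_measureReal_apply measurable_neg measurableSet_Ioi]
    congr 1
    ext x
    simp
  have h2 : Disjoint (Set.Iio (-t)) (Set.Ioi t) := by
    rw [Set.disjoint_left]
    intro x hx hx'
    simp only [Set.mem_Iio, Set.mem_Ioi] at hx hx'
    linarith
  have h3 := measureReal_union (μ := gaussianReal 0 1) h2 measurableSet_Ioi
  have h4 : (gaussianReal 0 1).real (Set.Iio (-t) ∪ Set.Ioi t) ≤ 1 := measureReal_le_one
  linarith

theorem integral_exp_sq_div_four :
    Integrable (fun x : ℝ => Real.exp (x ^ 2 / 4)) (gaussianReal 0 1) ∧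
    ∫ x, Real.exp (x ^ 2 / 4) ∂(gaussianReal 0 1) = √2 := by
  have h (x : ℝ) : gaussianPDFReal 0 1 x * Real.exp (x ^ 2 / 4) =
      (√(2 * Real.pi))⁻¹ * Real.exp (-(1 / 4) * x ^ 2) := by
    rw [gaussianPDFReal, mul_assoc, ← Real.exp_add]
    simp only [NNReal.coe_one, mul_one, sub_zero]
    ring_nf
  constructor
  · rw [gaussianReal_of_var_ne_zero _ one_ne_zero, integrable_withDensity_iff_integrable_smul'
      (measurable_gaussianPDF _ _) (ae_of_all _ fun _ => gaussianPDF_lt_top)]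
    simp only [toReal_gaussianPDF, smul_eq_mul, h]
    exact (integrable_exp_neg_mul_sq (by norm_num)).const_mul _
  · rw [integral_gaussianReal_eq_integral_smul one_ne_zero]
    simp only [smul_eq_mul, h]
    rw [integral_const_mul, integral_gaussian, ← Real.sqrt_inv, ← Real.sqrt_mul (by positivity)]
    congr 1
    field_simp
    norm_num

/-- An upper bound for the sum of the squares of any `k` entries of `g`. -/
noncomputable def topBound {p : ℕ} (k : ℕ) (L : ℝ) (g : Fin p → ℝ) : ℝ :=
  4 * k * L + ∑ j, 4 * Real.exp (-L) * Real.exp (g j ^ 2 / 4)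

/-- Each square is at most `4L` plus a positive excess, by `y + 1 ≤ exp y` at `y = x² / 4 - L`.
Summing the excess over all coordinates makes the bound independent of `S`; with `L = log (p / k)`
the total excess has expectation of order `k`. -/
theorem sum_sq_le_topBound {p k : ℕ} {L : ℝ} (hL : 0 ≤ L) (g : Fin p → ℝ) (S : Finset (Fin p))
    (hS : S.card ≤ k) : ∑ j ∈ S, g j ^ 2 ≤ topBound k L g := by
  have h (x : ℝ) : x ^ 2 ≤ 4 * L + 4 * Real.exp (-L) * Real.exp (x ^ 2 / 4) := by
    rw [mul_assoc, ← Real.exp_add]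
    have := Real.add_one_le_exp (-L + x ^ 2 / 4)
    linarith
  calc ∑ j ∈ S, g j ^ 2
      ≤ ∑ j ∈ S, (4 * L + 4 * Real.exp (-L) * Real.exp (g j ^ 2 / 4)) :=
        Finset.sum_le_sum fun j _ => h _
    _ = S.card * (4 * L) + ∑ j ∈ S, 4 * Real.exp (-L) * Real.exp (g j ^ 2 / 4) := by
        rw [Finset.sum_add_distrib]; simp
    _ ≤ k * (4 * L) + ∑ j, 4 * Real.exp (-L) * Real.exp (g j ^ 2 / 4) := by
        gcongr
        exact Finset.subset_univ S
    _ = topBound k L g := by rw [topBound]; ring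

theorem integral_topBound {p k : ℕ} {L : ℝ} :
    Integrable (topBound (p := p) k L) (noiseLaw p) ∧
    ∫ g, topBound (p := p) k L g ∂(noiseLaw p) = 4 * k * L + p * (4 * Real.exp (-L) * √2) := by
  obtain ⟨h1, h2⟩ := integral_exp_sq_div_four
  have h3 (j : Fin p) : Integrable (fun g : Fin p → ℝ => 4 * Real.exp (-L) * Real.exp (g j ^ 2 / 4))
      (noiseLaw p) :=
    integrable_comp_eval (μ := fun _ : Fin p => gaussianReal 0 1) (i := j) (h1.const_mul _)
  have h4 (j : Fin p) : ∫ g : Fin p → ℝ, 4 * Real.exp (-L) * Real.exp (g j ^ 2 / 4) ∂(noiseLaw p) =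
      4 * Real.exp (-L) * √2 := by
    rw [← h2, ← integral_const_mul]
    exact integral_comp_eval (μ := fun _ : Fin p => gaussianReal 0 1) (i := j)
      (f := fun x => 4 * Real.exp (-L) * Real.exp (x ^ 2 / 4)) (h1.const_mul _).aestronglyMeasurable
  have h5 := integrable_finsetSum Finset.univ fun j (_ : j ∈ Finset.univ) => h3 j
  refine ⟨(integrable_const _).add h5, ?_⟩
  unfold topBound
  rw [integral_add (integrable_const _) h5, integral_finsetSum _ fun j _ => h3 j]
  simp [h4]

theorem integral_exceedance {p : ℕ} (t : ℝ) (j : Fin p) :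
    Integrable (fun g : Fin p → ℝ => if t < g j then (1 : ℝ) else 0) (noiseLaw p) ∧
    ∫ g : Fin p → ℝ, (if t < g j then (1 : ℝ) else 0) ∂(noiseLaw p) =
      (gaussianReal 0 1).real (Set.Ioi t) := by
  have hm : Measurable fun x : ℝ => if t < x then (1 : ℝ) else 0 :=
    Measurable.ite measurableSet_Ioi measurable_const measurable_const
  constructor
  · refine Integrable.of_bound (hm.comp (measurable_pi_apply j)).aestronglyMeasurable 1
      (ae_of_all _ fun g => ?_)
    change ‖if t < g j then (1 : ℝ) else 0‖ ≤ 1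
    split_ifs <;> simp
  · refine (integral_comp_eval (μ := fun _ : Fin p => gaussianReal 0 1) (i := j)
      (f := fun x => if t < x then (1 : ℝ) else 0) hm.aestronglyMeasurable).trans ?_
    rw [← integral_indicator_one measurableSet_Ioi]
    congr 1

theorem integral_exceedance_mul_le {p : ℕ} (t : ℝ) (i j : Fin p) :
    Integrable (fun g : Fin p → ℝ => (if t < g i then (1 : ℝ) else 0) * if t < g j then 1 else 0)
      (noiseLaw p) ∧
    ∫ g : Fin p → ℝ, ((if t < g i then (1 : ℝ) else 0) * if t < g j then 1 else 0) ∂(noiseLaw p) ≤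
      (gaussianReal 0 1).real (Set.Ioi t) ^ 2 +
        if i = j then (gaussianReal 0 1).real (Set.Ioi t) else 0 := by
  have hm : Measurable fun x : ℝ => if t < x then (1 : ℝ) else 0 :=
    Measurable.ite measurableSet_Ioi measurable_const measurable_const
  have hm' (j : Fin p) : Measurable fun g : Fin p → ℝ => if t < g j then (1 : ℝ) else 0 :=
    hm.comp (measurable_pi_apply j)
  have hint (j : Fin p) := (integral_exceedance t j).2
  constructor
  · refine Integrable.of_bound ((hm' i).mul (hm' j)).aestronglyMeasurable 1
      (ae_of_all _ fun g => ?_)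
    split_ifs <;> simp
  · by_cases hij : i = j
    · subst hij
      have : ∀ g : Fin p → ℝ, ((if t < g i then (1 : ℝ) else 0) * if t < g i then 1 else 0) =
          if t < g i then 1 else 0 := fun g => by split_ifs <;> simp
      simp only [this, hint, if_true]
      nlinarith [sq_nonneg ((gaussianReal 0 1).real (Set.Ioi t))]
    · have hind : IndepFun (fun g : Fin p → ℝ => if t < g i then (1 : ℝ) else 0)
          (fun g => if t < g j then (1 : ℝ) else 0) (noiseLaw p) :=
        (iIndepFun_pi (μ := fun _ : Fin p => gaussianReal 0 1)
          (X := fun _ x => if t < x then (1 : ℝ) else 0) fun _ => hm.aemeasurable).indepFun hij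
      rw [hind.integral_fun_mul_eq_mul_integral (hm' i).aestronglyMeasurable
        (hm' j).aestronglyMeasurable, hint, hint, if_neg hij]
      linarith [sq ((gaussianReal 0 1).real (Set.Ioi t))]

/-- A data-driven choice of at most `k` coordinates of a standard Gaussian vector whose entries
exceed `t`, with a lower bound for the expected sum of the chosen entries. -/
theorem exists_selection {p k : ℕ} (hk : 1 ≤ k) (t : ℝ) (ht : 0 ≤ t) (J : Finset (Fin p)) :
    ∃ (s : (Fin p → ℝ) → EuclideanSpace ℝ (Fin p)) (H : (Fin p → ℝ) → ℝ),
      (∀ g, l0 (s g) ≤ k) ∧ (∀ g j, s g j = 0 ∨ s g j = 1) ∧ (∀ g, H g ≤ ∑ j, s g j * g j) ∧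
      Integrable H (noiseLaw p) ∧
      t * (J.card * (gaussianReal 0 1).real (Set.Ioi t) -
        (J.card * (gaussianReal 0 1).real (Set.Ioi t)) ^ 2 / k) ≤ ∫ g, H g ∂(noiseLaw p) := by
  classical
  set q := (gaussianReal 0 1).real (Set.Ioi t) with hq
  have hk0 : (0 : ℝ) < k := by exact_mod_cast hk
  let I : Fin p → (Fin p → ℝ) → ℝ := fun j g => if t < g j then 1 else 0
  -- With `N` the number of exceedances in `J`, all of them are selected if `N ≤ k` and none
  -- otherwise. The lower bound is `H = t (N - N (N - 1) / k)`, whose expectation needs only two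
  -- moments of `N`.
  let s : (Fin p → ℝ) → EuclideanSpace ℝ (Fin p) := fun g => WithLp.toLp 2 fun j =>
    if (j ∈ J ∧ t < g j) ∧ (J.filter fun i => t < g i).card ≤ k then 1 else 0
  let H : (Fin p → ℝ) → ℝ := fun g =>
    t * (∑ j ∈ J, I j g - (∑ i ∈ J, ∑ j ∈ J, I i g * I j g - ∑ j ∈ J, I j g) / k)
  have hN (g) : ∑ j ∈ J, I j g = ((J.filter fun i => t < g i).card : ℝ) := by simp [I]
  have hint1 : Integrable (fun g => ∑ j ∈ J, I j g) (noiseLaw p) :=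
    integrable_finsetSum _ fun j _ => (integral_exceedance t j).1
  have hint2 (i) : Integrable (fun g => ∑ j ∈ J, I i g * I j g) (noiseLaw p) :=
    integrable_finsetSum _ fun j _ => (integral_exceedance_mul_le t i j).1
  have hint3 : Integrable (fun g => ∑ i ∈ J, ∑ j ∈ J, I i g * I j g) (noiseLaw p) :=
    integrable_finsetSum _ fun i _ => hint2 i
  refine ⟨s, H, fun g => ?_, fun g j => ?_, fun g => ?_, ?_, ?_⟩
  · by_cases hc : (J.filter fun i => t < g i).card ≤ k
    · refine le_trans (Finset.card_le_card fun j hj => ?_) hc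
      simp only [Finset.mem_filter, Finset.mem_univ, true_and, s] at hj ⊢
      by_contra h
      exact hj (if_neg fun h' => h h'.1)
    · simp [l0, s, hc]
  · simp only [s]
    split_ifs <;> simp
  · set m := (J.filter fun i => t < g i).card with hm
    have hH : H g = t * (m - (m * m - m) / k) := by
      simp only [H]
      rw [← Finset.sum_mul_sum, hN]
    rw [hH]
    by_cases hc : m ≤ k
    · have h1 : ∑ j, s g j * g j = ∑ j ∈ J.filter fun i => t < g i, g j := by
        simp only [s, ← hm, hc, and_true, ite_mul, one_mul, zero_mul]
        rw [← Finset.sum_filter]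
        congr 1
        ext j
        simp
      have h2 : m * t ≤ ∑ j ∈ J.filter fun i => t < g i, g j := by
        rw [← nsmul_eq_mul]
        exact Finset.card_nsmul_le_sum _ _ _ fun j hj => (Finset.mem_filter.1 hj).2.le
      rw [h1]
      have h3 : (0 : ℝ) ≤ (m * m - m) / k := by
        apply div_nonneg _ hk0.le
        rcases Nat.eq_zero_or_pos m with h0 | h0
        · simp [h0]
        · have : (1 : ℝ) ≤ m := by exact_mod_cast h0
          nlinarith
      nlinarith
    · have h1 : ∑ j, s g j * g j = 0 := by simp [s, ← hm, hc]
      rw [h1]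
      -- When nothing is selected, `m - 1 ≥ k` makes the correction `m (m - 1) / k` at least `m`, so
      -- `H g ≤ 0`.
      have h2 : (k : ℝ) + 1 ≤ m := by exact_mod_cast not_le.1 hc
      have h3 : (m : ℝ) ≤ (m * m - m) / k := by
        rw [le_div_iff₀ hk0]
        nlinarith
      exact mul_nonpos_of_nonneg_of_nonpos ht (by linarith)
  · exact ((hint1.sub ((hint3.sub hint1).div_const _)).const_mul _)
  · have h1 : ∫ g, ∑ j ∈ J, I j g ∂(noiseLaw p) = J.card * q := by
      rw [integral_finsetSum _ fun j _ => (integral_exceedance t j).1]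
      simp [(integral_exceedance t _).2, hq]
    have h2 : ∫ g, ∑ i ∈ J, ∑ j ∈ J, I i g * I j g ∂(noiseLaw p) ≤ (J.card * q) ^ 2 + J.card * q := by
      rw [integral_finsetSum _ fun i _ => hint2 i]
      calc ∑ i ∈ J, ∫ g, ∑ j ∈ J, I i g * I j g ∂(noiseLaw p)
          = ∑ i ∈ J, ∑ j ∈ J, ∫ g, I i g * I j g ∂(noiseLaw p) :=
            Finset.sum_congr rfl fun i _ =>
              integral_finsetSum _ fun j _ => (integral_exceedance_mul_le t i j).1
        _ ≤ ∑ i ∈ J, ∑ j ∈ J, (q ^ 2 + if i = j then q else 0) :=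
            Finset.sum_le_sum fun i _ => Finset.sum_le_sum fun j _ =>
              (integral_exceedance_mul_le t i j).2
        _ = (J.card * q) ^ 2 + J.card * q := by
            simp only [Finset.sum_add_distrib, Finset.sum_const, nsmul_eq_mul, Finset.sum_ite_eq]
            rw [Finset.sum_ite_mem, Finset.inter_self]
            simp
            ring
    simp only [H]
    have hint4 : Integrable (fun g => (∑ i ∈ J, ∑ j ∈ J, I i g * I j g - ∑ j ∈ J, I j g) / k)
        (noiseLaw p) := (hint3.sub hint1).div_const _
    rw [integral_const_mul, integral_sub hint1 hint4, integral_div, integral_sub hint3 hint1, h1]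
    gcongr
    linarith

/-! ### Deterministic consequences of optimality -/

theorem rss_eq {n p : ℕ} (d : Design n p × (Fin n → ℝ)) (b : EuclideanSpace ℝ (Fin p)) :
    rss d b = ∑ i, d.2 i ^ 2 - 2 * ∑ j, b j * ∑ i, d.2 i * d.1 i j + ∑ i, predict d.1 b i ^ 2 := by
  have h : ∑ j, b j * ∑ i, d.2 i * d.1 i j = ∑ i, d.2 i * predict d.1 b i := by
    simp only [predict, Finset.mul_sum]
    rw [Finset.sum_comm]
    exact Finset.sum_congr rfl fun i _ => Finset.sum_congr rfl fun j _ => by ring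
  rw [h, rss, Finset.mul_sum, ← Finset.sum_sub_distrib, ← Finset.sum_add_distrib]
  exact Finset.sum_congr rfl fun i _ => by ring

theorem sum_mul_resample {n p : ℕ} {u : Fin n → ℝ} (hu : ∑ i, u i ^ 2 = 1)
    (w : Design n p × (Fin p → ℝ)) (j : Fin p) :
    ∑ i, u i * resample u w i j = w.2 j / √n := by
  have h (i : Fin n) : u i * resample u w i j =
      u i * w.1 i j - u i ^ 2 * (∑ l, u l * w.1 l j) + u i ^ 2 * (w.2 j / √n) := by
    rw [resample_apply]; ring
  simp only [h, Finset.sum_add_distrib, Finset.sum_sub_distrib, ← Finset.sum_mul, hu]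
  ring

theorem sum_predict_resample_sq_le {n p : ℕ} {u : Fin n → ℝ} (hu : ∑ i, u i ^ 2 = 1)
    (w : Design n p × (Fin p → ℝ)) (b : EuclideanSpace ℝ (Fin p)) :
    ∑ i, predict (resample u w) b i ^ 2 ≤
      ∑ i, predict w.1 b i ^ 2 + (∑ j, b j * w.2 j) ^ 2 / n := by
  set c := ∑ l, u l * predict w.1 b l with hc
  set e := (∑ j, b j * w.2 j) / √n with he
  have h (i : Fin n) : predict (resample u w) b i = predict w.1 b i - u i * c + u i * e := by
    have h1 : c = ∑ j, (∑ l, u l * w.1 l j) * b j := by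
      simp only [hc, predict, Finset.mul_sum, Finset.sum_mul]
      rw [Finset.sum_comm]
      exact Finset.sum_congr rfl fun i _ => Finset.sum_congr rfl fun j _ => by ring
    simp only [predict, h1, he, resample_apply]
    rw [Finset.sum_div, Finset.mul_sum, Finset.mul_sum, ← Finset.sum_sub_distrib,
      ← Finset.sum_add_distrib]
    exact Finset.sum_congr rfl fun j _ => by ring
  have h2 (i : Fin n) : predict (resample u w) b i ^ 2 = predict w.1 b i ^ 2
      + 2 * (e - c) * (u i * predict w.1 b i) + (e - c) ^ 2 * u i ^ 2 := by
    rw [h]; ring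
  simp only [h2, Finset.sum_add_distrib, ← Finset.mul_sum, hu, ← hc]
  have h3 : (∑ j, b j * w.2 j) ^ 2 / n = e ^ 2 := by
    rw [he, div_pow, Real.sq_sqrt (Nat.cast_nonneg n)]
  rw [h3]
  -- The sum equals `‖Xb‖² - c² + e²`, and `c²` is dropped.
  nlinarith [sq_nonneg c]

/-- A lower bound for the squared norm of the best subset selection estimator when the response
is pure noise. -/
theorem norm_sq_bestSubset_ge {n p k : ℕ} {L lam σ : ℝ} (hL : 0 ≤ L) (hlam : 0 < lam)
    {δ : Estimator n p} (hδ : IsBestSubsetSelection k δ) {u : Fin n → ℝ} (hu : ∑ i, u i ^ 2 = 1)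
    (r : ℝ) (w : Design n p × (Fin p → ℝ)) (b : EuclideanSpace ℝ (Fin p)) (hb : l0 b ≤ k) :
    (σ * r) ^ 2 * (2 * ∑ j, b j * w.2 j - ∑ i, predict w.1 b i ^ 2 - (∑ j, b j * w.2 j) ^ 2 / n
        - topBound k L w.2 / lam) ≤
      lam * ‖δ (resample u w, fun i => σ * (r * √n * u i))‖ ^ 2 := by
  have hn : (0 : ℝ) < √n := by
    refine Real.sqrt_pos.2 (Nat.cast_pos.2 (Nat.pos_of_ne_zero ?_))
    rintro rfl
    simp at hu
  set d : Design n p × (Fin n → ℝ) := (resample u w, fun i => σ * (r * √n * u i)) with hd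
  have hcorr (j : Fin p) : ∑ i, d.2 i * d.1 i j = σ * r * w.2 j := by
    have h : ∀ i, d.2 i * d.1 i j = (σ * r * √n) * (u i * resample u w i j) := fun i => by
      simp only [hd]; ring
    simp only [h, ← Finset.mul_sum, sum_mul_resample hu]
    field_simp
  set v := δ d with hv
  obtain ⟨hv0, hopt⟩ := hδ d
  have hb' : l0 ((σ * r) • b) ≤ k := by
    refine le_trans (Finset.card_le_card fun j hj => ?_) hb
    rw [Finset.mem_filter] at hj ⊢
    exact ⟨hj.1, right_ne_zero_of_mul (a := σ * r) hj.2⟩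
  -- The competitor is scaled by `σ r` so that the whole inequality is homogeneous in `(σ r)²`.
  have h1 := hopt _ hb'
  rw [rss_eq, rss_eq] at h1
  simp only [hcorr, ← hv] at h1
  have h2 : ∑ j, ((σ * r) • b) j * (σ * r * w.2 j) = (σ * r) ^ 2 * ∑ j, b j * w.2 j := by
    rw [Finset.mul_sum]
    exact Finset.sum_congr rfl fun j _ => by simp only [PiLp.smul_apply, smul_eq_mul]; ring
  have h3 : ∑ i, predict d.1 ((σ * r) • b) i ^ 2 = (σ * r) ^ 2 * ∑ i, predict d.1 b i ^ 2 := by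
    rw [Finset.mul_sum]
    refine Finset.sum_congr rfl fun i _ => ?_
    rw [← mul_pow, predict, predict, Finset.mul_sum]
    congr 1
    exact Finset.sum_congr rfl fun j _ => by simp only [PiLp.smul_apply, smul_eq_mul]; ring
  rw [h2, h3] at h1
  have h4 : (0 : ℝ) ≤ ∑ i, predict d.1 v i ^ 2 := Finset.sum_nonneg fun i _ => sq_nonneg _
  have h5 := mul_le_mul_of_nonneg_left (sum_predict_resample_sq_le hu w b) (sq_nonneg (σ * r))
  -- Weighted Young inequality on the support of `v`, which has at most `k` elements.
  have h6 : 2 * ∑ j, v j * (σ * r * w.2 j) ≤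
      lam * ‖v‖ ^ 2 + (σ * r) ^ 2 * topBound k L w.2 / lam := by
    set S := Finset.univ.filter fun j => v j ≠ 0 with hS
    have h7 := sum_sq_le_topBound hL w.2 S hv0
    have h8 : ∑ j, v j * (σ * r * w.2 j) = ∑ j ∈ S, v j * (σ * r * w.2 j) := by
      rw [hS, Finset.sum_filter]
      exact Finset.sum_congr rfl fun j _ => by split_ifs with h <;> simp_all
    have h9 : ∑ j ∈ S, v j ^ 2 ≤ ‖v‖ ^ 2 := by
      rw [EuclideanSpace.real_norm_sq_eq]
      exact Finset.sum_le_sum_of_subset_of_nonneg (Finset.subset_univ _) fun _ _ _ => sq_nonneg _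
    calc 2 * ∑ j, v j * (σ * r * w.2 j)
        ≤ ∑ j ∈ S, (lam * v j ^ 2 + (σ * r) ^ 2 / lam * w.2 j ^ 2) := by
          rw [h8, Finset.mul_sum]
          refine Finset.sum_le_sum fun j _ => ?_
          have : lam * v j ^ 2 + (σ * r) ^ 2 / lam * w.2 j ^ 2 - 2 * (v j * (σ * r * w.2 j)) =
              (lam * v j - σ * r * w.2 j) ^ 2 / lam := by
            field_simp
            ring
          have h0 : 0 ≤ (lam * v j - σ * r * w.2 j) ^ 2 / lam := by positivity
          linarith
      _ = lam * ∑ j ∈ S, v j ^ 2 + (σ * r) ^ 2 / lam * ∑ j ∈ S, w.2 j ^ 2 := by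
          rw [Finset.sum_add_distrib, Finset.mul_sum, Finset.mul_sum]
      _ ≤ lam * ‖v‖ ^ 2 + (σ * r) ^ 2 / lam * topBound k L w.2 := by gcongr
      _ = _ := by ring
  have h10 : (σ * r) ^ 2 * (2 * ∑ j, b j * w.2 j - ∑ i, predict w.1 b i ^ 2 -
      (∑ j, b j * w.2 j) ^ 2 / n - topBound k L w.2 / lam) =
      2 * ((σ * r) ^ 2 * ∑ j, b j * w.2 j) - (σ * r) ^ 2 * (∑ i, predict w.1 b i ^ 2 +
      (∑ j, b j * w.2 j) ^ 2 / n) - (σ * r) ^ 2 * topBound k L w.2 / lam := by ring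
  rw [h10]
  have h11 : d.1 = resample u w := rfl
  rw [h11] at h1 h4
  linarith

/-! ### Expected risk of best subset selection under pure noise -/

theorem exists_selection_of_log {p k : ℕ} (hk : 1 ≤ k) (hkp : k ≤ p)
    (hL : 4 ≤ Real.log ((p : ℝ) / k)) :
    ∃ (s : (Fin p → ℝ) → EuclideanSpace ℝ (Fin p)) (H : (Fin p → ℝ) → ℝ),
      (∀ g, l0 (s g) ≤ k) ∧ (∀ g j, s g j = 0 ∨ s g j = 1) ∧ (∀ g, H g ≤ ∑ j, s g j * g j) ∧
      Integrable H (noiseLaw p) ∧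
      √(Real.log ((p : ℝ) / k) / 2) * (3 / 16 * k) ≤ ∫ g, H g ∂(noiseLaw p) := by
  set L := Real.log ((p : ℝ) / k) with hLdef
  set t := √(L / 2) with ht
  have ht0 : 0 ≤ t := Real.sqrt_nonneg _
  set q := (gaussianReal 0 1).real (Set.Ioi t) with hq
  have hk0 : (1 : ℝ) ≤ k := by exact_mod_cast hk
  have hp0 : (0 : ℝ) < p := by exact_mod_cast lt_of_lt_of_le hk hkp
  have hq1 : (k : ℝ) / (2 * p) ≤ q := by
    refine le_trans ?_ (le_gaussianReal_Ioi t ht0)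
    have h1 : (k : ℝ) / (2 * p) = Real.exp (-L) / 2 := by
      rw [hLdef, Real.exp_neg, Real.exp_log (by positivity)]
      field_simp
    have h2 : √(2 * Real.pi) ≤ Real.exp 1 := by
      rw [Real.sqrt_le_left (Real.exp_pos 1).le]
      nlinarith [Real.pi_lt_d2, Real.exp_one_gt_d9]
    rw [h1, div_le_div_iff₀ two_pos (by positivity), ht, Real.sq_sqrt (by linarith)]
    calc Real.exp (-L) * √(2 * Real.pi) ≤ Real.exp (-L) * Real.exp 1 := by gcongr
      _ = Real.exp (-L + 1) := by rw [Real.exp_add]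
      _ ≤ Real.exp (-(L / 2) - 1) := Real.exp_le_exp.2 (by linarith)
      _ ≤ Real.exp (-(L / 2) - 1) * 2 := by linarith [Real.exp_pos (-(L / 2) - 1)]
  have hq2 : q ≤ 1 / 2 := gaussianReal_Ioi_le_half t ht0
  have hq0 : 0 < q := lt_of_lt_of_le (by positivity) hq1
  -- The size of `J` is tuned so that the mean number of exceedances `m q` lies in `[k / 4, k / 2]`,
  -- where `x - x² / k ≥ 3k / 16`. The bound `q ≤ 1 / 2` gives `m ≥ 1`, so rounding down loses at
  -- most half; `q ≥ k / (2p)` gives `m ≤ p`.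
  set m := ⌊(k : ℝ) / (2 * q)⌋₊ with hm
  have hm1 : (m : ℝ) * q ≤ k / 2 := by
    have : (m : ℝ) ≤ k / (2 * q) := Nat.floor_le (by positivity)
    rw [le_div_iff₀ (by positivity)] at this
    linarith
  have hm2 : (k : ℝ) / 4 ≤ m * q := by
    have h1 : (k : ℝ) / (2 * q) < m + 1 := Nat.lt_floor_add_one _
    have h2 : (1 : ℝ) ≤ k / (2 * q) := by rw [le_div_iff₀ (by positivity)]; linarith
    have h3 : (1 : ℝ) ≤ m := by exact_mod_cast Nat.le_floor (by simpa using h2)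
    rw [div_lt_iff₀ (by positivity)] at h1
    nlinarith
  have hmp : m ≤ p := by
    have h1 : (k : ℝ) / (2 * q) ≤ p := by
      rw [div_le_iff₀ (by positivity)] at hq1 ⊢
      linarith
    exact_mod_cast (Nat.floor_le (by positivity)).trans h1
  obtain ⟨J, -, hJ⟩ := Finset.exists_subset_card_eq (s := (Finset.univ : Finset (Fin p)))
    (n := m) (by simpa using hmp)
  obtain ⟨s, H, h1, h2, h3, h4, h5⟩ := exists_selection hk t ht0 J
  refine ⟨s, H, h1, h2, h3, h4, le_trans ?_ h5⟩
  gcongr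
  rw [hJ, ← hq]
  set x := (m : ℝ) * q
  have : x - x ^ 2 / k = (k * x - x ^ 2) / k := by field_simp
  rw [this, le_div_iff₀ (by positivity)]
  nlinarith

theorem ofReal_integral_le_lintegral {α : Type*} [MeasurableSpace α] {μ : Measure α} {f : α → ℝ}
    (hf : Integrable f μ) : ENNReal.ofReal (∫ x, f x ∂μ) ≤ ∫⁻ x, ENNReal.ofReal (f x) ∂μ := by
  calc ENNReal.ofReal (∫ x, f x ∂μ) ≤ ENNReal.ofReal (∫ x, max (f x) 0 ∂μ) :=
        ENNReal.ofReal_le_ofReal (integral_mono hf hf.pos_part fun x => le_max_left _ _)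
    _ = ∫⁻ x, ENNReal.ofReal (max (f x) 0) ∂μ :=
        ofReal_integral_eq_lintegral_ofReal hf.pos_part (ae_of_all _ fun x => le_max_right _ _)
    _ = ∫⁻ x, ENNReal.ofReal (f x) ∂μ := by simp [ENNReal.ofReal_max]

theorem lintegral_bestSubset_ge {n p k : ℕ} (σ : ℝ) (hk : 1 ≤ k) (hkp : k ≤ p)
    (hL : 4 ≤ Real.log ((p : ℝ) / k)) (hn : 20 * (k * Real.log ((p : ℝ) / k)) ≤ n)
    {δ : Estimator n p} (hδm : Measurable δ) (hδ : IsBestSubsetSelection k δ) {u : Fin n → ℝ}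
    (hu : ∑ i, u i ^ 2 = 1) (r : ℝ) :
    ENNReal.ofReal ((σ * r) ^ 2 * (k * Real.log ((p : ℝ) / k) / 128)) ≤
      ∫⁻ x, ENNReal.ofReal (2560 * ‖δ (x, fun i => σ * (r * √n * u i))‖ ^ 2)
        ∂(designLaw n p) := by
  obtain ⟨s, H, hs0, hs1, hs2, hH, hHint⟩ := exists_selection_of_log hk hkp hL
  set L := Real.log ((p : ℝ) / k) with hLdef
  set t := √(L / 2) with ht
  have ht2 : t ^ 2 = L / 2 := Real.sq_sqrt (by linarith)
  have ht0 : 0 ≤ t := Real.sqrt_nonneg _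
  have hk0 : (1 : ℝ) ≤ k := by exact_mod_cast hk
  have hp0 : (0 : ℝ) < p := by exact_mod_cast lt_of_lt_of_le hk hkp
  have hn0 : (0 : ℝ) < n := by nlinarith
  obtain ⟨hM, hMint⟩ := integral_topBound (p := p) (k := k) (L := L)
  have hMint' : ∫ g, topBound (p := p) k L g ∂(noiseLaw p) ≤ 10 * k * L := by
    rw [hMint, hLdef, Real.exp_neg, Real.exp_log (by positivity), ← hLdef]
    have h1 : (p : ℝ) * (4 * (p / k : ℝ)⁻¹ * √2) = 4 * √2 * k := by field_simp
    have h2 : √2 ≤ 6 := by rw [Real.sqrt_le_left (by norm_num)]; norm_num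
    rw [h1]
    nlinarith
  have hsq (g) : ‖s g‖ ^ 2 ≤ k := by
    rw [EuclideanSpace.real_norm_sq_eq]
    refine le_trans (le_of_eq ?_) (Nat.cast_le.2 (hs0 g))
    rw [l0, Finset.card_filter]
    push_cast
    refine Finset.sum_congr rfl fun j _ => ?_
    rcases hs1 g j with h | h <;> simp [h]
  have hsg (g) : (∑ j, s g j * g j) ^ 2 ≤ k * topBound k L g := by
    have h1 : ∑ j, s g j * g j = ∑ j ∈ Finset.univ.filter fun j => s g j ≠ 0, s g j * g j := by
      rw [Finset.sum_filter]
      exact Finset.sum_congr rfl fun j _ => by split_ifs with h <;> simp_all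
    rw [h1]
    refine (Finset.sum_mul_sq_le_sq_mul_sq _ _ _).trans ?_
    have h2 := sum_sq_le_topBound (L := L) (by linarith) g _ (hs0 g)
    have h3 : ∑ j ∈ Finset.univ.filter fun j => s g j ≠ 0, s g j ^ 2 ≤ (k : ℝ) := by
      refine le_trans ?_ (hsq g)
      rw [EuclideanSpace.real_norm_sq_eq]
      exact Finset.sum_le_sum_of_subset_of_nonneg (Finset.subset_univ _) fun _ _ _ => sq_nonneg _
    gcongr
  set y : Fin n → ℝ := fun i => σ * (r * √n * u i) with hy
  -- With this amplitude the gain is `3kL/128` and the quadratic cost `kL/128`. The `1 / n` term and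
  -- the top-k term (weight `1/2560` on `10kL`) cost at most `kL/256` each, leaving `kL/128`.
  set a := t / 8 with ha
  have ha0 : 0 ≤ a := by positivity
  have hmeas : Measurable fun x : Design n p => ENNReal.ofReal (2560 * ‖δ (x, y)‖ ^ 2) :=
    (((hδm.comp measurable_prodMk_right).norm.pow_const 2).const_mul 2560).ennreal_ofReal
  have hmeas' : Measurable fun w : Design n p × (Fin p → ℝ) =>
      ENNReal.ofReal (2560 * ‖δ (resample u w, y)‖ ^ 2) :=
    hmeas.comp (resample u).continuous.measurable
  rw [← map_resample u hu, lintegral_map hmeas (resample u).continuous.measurable,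
    lintegral_prod_symm _ hmeas'.aemeasurable]
  set F : (Fin p → ℝ) → ℝ := fun g =>
    (σ * r) ^ 2 * (2 * a * H g - a ^ 2 * k - (a ^ 2 * k / n + 1 / 2560) * topBound k L g) with hF
  have hFint : Integrable F (noiseLaw p) :=
    (((hH.const_mul _).sub (integrable_const _)).sub (hM.const_mul _)).const_mul _
  -- For fixed `g` the competitor `a • s g` is deterministic and the original design is independent
  -- of it, so `‖Xb‖²` has mean `‖b‖²`.
  have key (g : Fin p → ℝ) : ENNReal.ofReal (F g) ≤
      ∫⁻ x, ENNReal.ofReal (2560 * ‖δ (resample u (x, g), y)‖ ^ 2) ∂(designLaw n p) := by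
    set e := ∑ j, (a • s g) j * g j with he
    have hea : e = a * ∑ j, s g j * g j := by
      rw [he, Finset.mul_sum]
      exact Finset.sum_congr rfl fun j _ => by simp only [PiLp.smul_apply, smul_eq_mul]; ring
    have hl0 : l0 (a • s g) ≤ k := by
      refine le_trans (Finset.card_le_card fun j hj => ?_) (hs0 g)
      rw [Finset.mem_filter] at hj ⊢
      exact ⟨hj.1, right_ne_zero_of_mul (a := a) hj.2⟩
    set G : Design n p → ℝ := fun x => (σ * r) ^ 2 * (2 * e -
      ∑ i, predict x (a • s g) i ^ 2 - e ^ 2 / n - topBound k L g / 2560) with hG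
    have hpint : Integrable (fun x : Design n p => ∑ i, predict x (a • s g) i ^ 2)
        (designLaw n p) := integrable_finsetSum _ fun i _ => (integral_predict_sq _ i).1
    have hGint : Integrable G (designLaw n p) :=
      ((((integrable_const _).sub hpint).sub (integrable_const _)).sub
        (integrable_const _)).const_mul _
    have hGval : ∫ x, G x ∂(designLaw n p) = (σ * r) ^ 2 * (2 * e - ‖a • s g‖ ^ 2 - e ^ 2 / n -
        topBound k L g / 2560) := by
      have h1 : ∫ x : Design n p, ∑ i, predict x (a • s g) i ^ 2 ∂(designLaw n p) =
          ‖a • s g‖ ^ 2 := by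
        rw [integral_finsetSum _ fun i _ => (integral_predict_sq _ i).1]
        simp only [(integral_predict_sq _ _).2]
        simp
        field_simp
      have h2 : G = fun x => (σ * r) ^ 2 * (2 * e - e ^ 2 / n - topBound k L g / 2560) -
          (σ * r) ^ 2 * ∑ i, predict x (a • s g) i ^ 2 := by
        ext x; simp only [hG]; ring
      rw [h2, integral_sub (integrable_const _) (hpint.const_mul _), integral_const_mul, integral_const_mul, h1]
      simp
      ring
    calc ENNReal.ofReal (F g) ≤ ENNReal.ofReal (∫ x, G x ∂(designLaw n p)) := by
          apply ENNReal.ofReal_le_ofReal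
          rw [hGval]
          apply mul_le_mul_of_nonneg_left _ (sq_nonneg _)
          have h1 : ‖a • s g‖ ^ 2 ≤ a ^ 2 * k := by
            rw [norm_smul, mul_pow, Real.norm_eq_abs, sq_abs]
            exact mul_le_mul_of_nonneg_left (hsq g) (sq_nonneg a)
          have h2 : e ^ 2 / n ≤ a ^ 2 * k / n * topBound k L g := by
            rw [hea, mul_pow, div_mul_eq_mul_div, mul_assoc]
            have := hsg g
            gcongr
          have h3 : a * H g ≤ e := by
            rw [hea]
            exact mul_le_mul_of_nonneg_left (hs2 g) ha0
          linarith
      _ ≤ ∫⁻ x, ENNReal.ofReal (G x) ∂(designLaw n p) := ofReal_integral_le_lintegral hGint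
      _ ≤ _ := lintegral_mono fun x => ENNReal.ofReal_le_ofReal
          (norm_sq_bestSubset_ge (by linarith) (by norm_num) hδ hu r (x, g) (a • s g) hl0)
  refine le_trans ?_ (lintegral_mono key)
  refine le_trans (ENNReal.ofReal_le_ofReal ?_) (ofReal_integral_le_lintegral hFint)
  have hFval : ∫ g, F g ∂(noiseLaw p) = (σ * r) ^ 2 * (2 * a * ∫ g, H g ∂(noiseLaw p) -
      a ^ 2 * k - (a ^ 2 * k / n + 1 / 2560) * ∫ g, topBound k L g ∂(noiseLaw p)) := by
    simp only [hF]
    have hi : Integrable (fun g => 2 * a * H g - a ^ 2 * k) (noiseLaw p) :=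
      (hH.const_mul _).sub (integrable_const _)
    rw [integral_const_mul, integral_sub hi (hM.const_mul _),
      integral_sub (hH.const_mul _) (integrable_const _), integral_const_mul, integral_const_mul,
      integral_const_mul]
    simp
  rw [hFval]
  apply mul_le_mul_of_nonneg_left _ (sq_nonneg _)
  have h1 : 2 * a * (t * (3 / 16 * k)) ≤ 2 * a * ∫ g, H g ∂(noiseLaw p) := by gcongr
  have h2 : (a ^ 2 * k / n + 1 / 2560) * ∫ g, topBound k L g ∂(noiseLaw p) ≤
      (a ^ 2 * k / n + 1 / 2560) * (10 * k * L) := by gcongr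
  have h3 : a ^ 2 = L / 128 := by rw [ha, div_pow, ht2]; ring
  have h4 : 2 * a * (t * (3 / 16 * k)) = 3 / 128 * k * L := by
    rw [ha]
    linear_combination (3 / 64 * k : ℝ) * ht2
  have h5 : a ^ 2 * k / n * (10 * k * L) ≤ k * L / 256 := by
    rw [h3, div_mul_eq_mul_div, div_le_iff₀ hn0]
    have : 0 ≤ k * L := by nlinarith
    nlinarith
  rw [h4] at h1
  rw [h3] at h2 h5 ⊢
  nlinarith

theorem integral_sq_noiseLaw {n : ℕ} (i : Fin n) :
    Integrable (fun z : Fin n → ℝ => z i ^ 2) (noiseLaw n) ∧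
    ∫ z, z i ^ 2 ∂(noiseLaw n) = 1 := by
  have h : Integrable (fun x : ℝ => x ^ 2) (gaussianReal 0 1) :=
    (memLp_id_gaussianReal' 2 (by simp)).integrable_sq
  refine ⟨integrable_comp_eval (μ := fun _ : Fin n => gaussianReal 0 1) (i := i) h,
    (integral_comp_eval (μ := fun _ : Fin n => gaussianReal 0 1) (i := i)
      (f := fun x => x ^ 2) h.aestronglyMeasurable).trans ?_⟩
  have := variance_id_gaussianReal (μ := 0) (v := 1)
  rw [variance_eq_integral aemeasurable_id] at this
  simpa using this

theorem measurable_response {n p : ℕ} (σ : ℝ) (β : EuclideanSpace ℝ (Fin p)) :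
    Measurable fun w : Design n p × (Fin n → ℝ) => (w.1, predict w.1 β + σ • w.2) := by
  unfold predict
  fun_prop

theorem zero_mem_Theta (p k : ℕ) (τ : ℝ) : 0 ∈ Theta p k τ := by
  refine ⟨by simp [l0], ?_⟩
  have : 0 ≤ (k : ℝ) * τ ^ 2 := by positivity
  simpa using this

theorem worstRisk_bestSubset_ge {n p k : ℕ} (τ σ : ℝ) (hk : 1 ≤ k) (hkp : k ≤ p)
    (hL : 4 ≤ Real.log ((p : ℝ) / k)) (hn : 20 * (k * Real.log ((p : ℝ) / k)) ≤ n)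
    {δ : Estimator n p} (hδm : Measurable δ) (hδ : IsBestSubsetSelection k δ) :
    ENNReal.ofReal (σ ^ 2 * (k * Real.log ((p : ℝ) / k) / 327680)) ≤ worstRisk k τ σ δ := by
  refine le_trans ?_ (le_iSup₂ (f := fun β (_ : β ∈ Theta p k τ) => risk σ δ β) 0
    (zero_mem_Theta p k τ))
  set L := Real.log ((p : ℝ) / k)
  have hn0 : (0 : ℝ) < n := by
    have : (1 : ℝ) ≤ k := by exact_mod_cast hk
    nlinarith
  have hmeas0 : Measurable fun d => ENNReal.ofReal (‖δ d - 0‖ ^ 2) :=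
    ((hδm.sub_const 0).norm.pow_const 2).ennreal_ofReal
  have hmeas : Measurable fun w : Design n p × (Fin n → ℝ) =>
      ENNReal.ofReal (‖δ (w.1, predict w.1 0 + σ • w.2) - 0‖ ^ 2) :=
    hmeas0.comp (measurable_response σ 0)
  rw [risk, dataLaw, lintegral_map hmeas0 (measurable_response σ 0),
    lintegral_prod_symm _ hmeas.aemeasurable]
  have key (z : Fin n → ℝ) : ENNReal.ofReal (σ ^ 2 * (k * L / 327680) / n * ∑ i, z i ^ 2) ≤
      ∫⁻ x, ENNReal.ofReal (‖δ (x, predict x 0 + σ • z) - 0‖ ^ 2) ∂(designLaw n p) := by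
    rcases (Finset.sum_nonneg fun i (_ : i ∈ Finset.univ) => sq_nonneg (z i)).eq_or_lt with h0 | h0
    · simp [← h0]
    set c := √(∑ i, z i ^ 2) with hc
    have hc0 : 0 < c := Real.sqrt_pos.2 h0
    have hc2 : c ^ 2 = ∑ i, z i ^ 2 := Real.sq_sqrt h0.le
    have hu : ∑ i, (z i / c) ^ 2 = 1 := by
      simp only [div_pow, ← Finset.sum_div, ← hc2]
      field_simp
    -- Polar form of the noise: direction `z / c`, radius `r = c / √n`, so that the response is
    -- exactly `σ • z`.
    have h := lintegral_bestSubset_ge σ hk hkp hL hn hδm hδ hu (c / √n)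
    have hy : (fun i => σ * (c / √n * √n * (z i / c))) = σ • z := by
      ext i
      have : √(n : ℝ) ≠ 0 := (Real.sqrt_pos.2 hn0).ne'
      simp only [Pi.smul_apply, smul_eq_mul]
      field_simp
    have hpred (x : Design n p) : predict x 0 = 0 := by ext i; simp [predict]
    simp only [hy, ENNReal.ofReal_mul (show (0 : ℝ) ≤ 2560 by norm_num)] at h
    rw [lintegral_const_mul' _ _ ENNReal.ofReal_ne_top] at h
    simp only [hpred, zero_add, sub_zero]
    have h1 : (σ * (c / √n)) ^ 2 * (k * L / 128) =
        2560 * (σ ^ 2 * (k * L / 327680) / n * ∑ i, z i ^ 2) := by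
      rw [← hc2, mul_pow, div_pow, Real.sq_sqrt hn0.le]
      ring
    rw [h1, ENNReal.ofReal_mul (show (0 : ℝ) ≤ 2560 by norm_num)] at h
    exact (ENNReal.mul_le_mul_iff_right (by simp) ENNReal.ofReal_ne_top).1 h
  refine le_trans ?_ (lintegral_mono key)
  have hint := integrable_finsetSum Finset.univ
    fun i (_ : i ∈ Finset.univ) => (integral_sq_noiseLaw (n := n) i).1
  refine le_trans (le_of_eq ?_) (ofReal_integral_le_lintegral (hint.const_mul _))
  rw [integral_const_mul, integral_finsetSum _ fun i _ => (integral_sq_noiseLaw i).1]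
  simp only [(integral_sq_noiseLaw _).2]
  simp
  congr 1
  field_simp

/-! ### Minimax upper bound and divergence of the ratio -/

theorem minimaxRisk_le (n p k : ℕ) (τ σ : ℝ) :
    minimaxRisk n p k τ σ ≤ ENNReal.ofReal (k * τ ^ 2) := by
  refine (iInf₂_le (fun _ => 0) measurable_const).trans (iSup₂_le fun β hβ => ?_)
  have : IsProbabilityMeasure (dataLaw n p σ β) :=
    Measure.isProbabilityMeasure_map (measurable_response σ β).aemeasurable
  rw [risk]
  simp only [zero_sub, norm_neg, lintegral_const, measure_univ, mul_one]
  exact ENNReal.ofReal_le_ofReal hβ.2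

end SparseRegression

theorem mainTheorem2 (p k : ℕ → ℕ) (τ σ : ℕ → ℝ)
    (hk : ∀ n, 1 ≤ k n) (hkp : ∀ n, k n ≤ p n)
    (hτ : ∀ n, 0 < τ n) (hσ : ∀ n, 0 < σ n)
    (hsparse : Tendsto (fun n => (k n : ℝ) / (p n : ℝ)) atTop (𝓝 0))
    (hsample : Tendsto (fun n => (k n : ℝ) * Real.log (p n : ℝ) / (n : ℝ)) atTop (𝓝 0))
    (hsnr : (fun n => τ n / σ n) =o[atTop]
      fun n => Real.sqrt (Real.log ((p n : ℝ) / (k n : ℝ))))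
    (βBS : ∀ n, SparseRegression.Estimator n (p n))
    (hmeas : ∀ n, Measurable (βBS n))
    (hBS : ∀ n, SparseRegression.IsBestSubsetSelection (k n) (βBS n)) :
    Tendsto
      (fun n => SparseRegression.worstRisk (k n) (τ n) (σ n) (βBS n) /
        SparseRegression.minimaxRisk n (p n) (k n) (τ n) (σ n))
      atTop (𝓝 ⊤) := by
  have hp0 (n) : (0 : ℝ) < p n := by exact_mod_cast lt_of_lt_of_le (hk n) (hkp n)
  have hk0 (n) : (1 : ℝ) ≤ k n := by exact_mod_cast hk n
  have hratio : Tendsto (fun n => (p n : ℝ) / k n) atTop atTop := by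
    have h : Tendsto (fun n => (k n : ℝ) / p n) atTop (𝓝[>] 0) :=
      tendsto_nhdsWithin_iff.2 ⟨hsparse, Eventually.of_forall fun n =>
        div_pos (by linarith [hk0 n]) (hp0 n)⟩
    simpa [Function.comp_def] using tendsto_inv_nhdsGT_zero.comp h
  have hlog := Real.tendsto_log_atTop.comp hratio
  rw [ENNReal.tendsto_nhds_top_iff_nnreal]
  intro x
  -- The constant is `128 * 2560` from the risk bound; `x + 1` in place of `x` makes the final
  -- inequality strict.
  have hε : 0 < √(1 / (327680 * (x + 1)) : ℝ) := Real.sqrt_pos.2 (by positivity)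
  filter_upwards [hlog.eventually_ge_atTop 4, hsample.eventually_lt_const
    (show (0 : ℝ) < 1 / 20 by norm_num), isLittleO_iff.1 hsnr hε, eventually_gt_atTop 0]
    with n hL hs hr hn
  simp only [Function.comp_apply] at hL
  have hn0 : (0 : ℝ) < n := by exact_mod_cast hn
  have hτn := hτ n
  have hσn := hσ n
  have hkn := hk0 n
  set L := Real.log ((p n : ℝ) / k n) with hLdef
  have hLp : L ≤ Real.log (p n) :=
    Real.log_le_log (div_pos (hp0 n) (by linarith)) (div_le_self (hp0 n).le hkn)
  have hsize : 20 * (k n * L) ≤ n := by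
    rw [div_lt_iff₀ hn0] at hs
    nlinarith
  have h1 := SparseRegression.worstRisk_bestSubset_ge (τ n) (σ n) (hk n) (hkp n) hL hsize
    (hmeas n) (hBS n)
  have h2 := SparseRegression.minimaxRisk_le n (p n) (k n) (τ n) (σ n)
  have hsq : τ n ^ 2 * (327680 * (x + 1)) ≤ σ n ^ 2 * L := by
    rw [Real.norm_of_nonneg (by positivity), Real.norm_of_nonneg (by positivity),
      ← Real.sqrt_mul (by positivity)] at hr
    have h3 := pow_le_pow_left₀ (by positivity) hr 2
    rw [Real.sq_sqrt (by positivity), div_pow, div_mul_eq_mul_div, one_mul,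
      div_le_div_iff₀ (by positivity) (by positivity)] at h3
    linarith
  calc (x : ℝ≥0∞) = ENNReal.ofReal x := by simp
    _ < ENNReal.ofReal (σ n ^ 2 * (k n * L / 327680) / (k n * τ n ^ 2)) := by
        rw [ENNReal.ofReal_lt_ofReal_iff_of_nonneg x.coe_nonneg, lt_div_iff₀ (by positivity)]
        have h4 : 0 < (k n : ℝ) * τ n ^ 2 := by positivity
        have h5 := mul_le_mul_of_nonneg_left hsq (show (0 : ℝ) ≤ k n / 327680 by positivity)
        nlinarith
    _ = ENNReal.ofReal (σ n ^ 2 * (k n * L / 327680)) / ENNReal.ofReal (k n * τ n ^ 2) :=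
        ENNReal.ofReal_div_of_pos (by positivity)
    _ ≤ _ := ENNReal.div_le_div h1 h2
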